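/- Let $K$ be a field and $S=K[x_1,\dots,x_n]$. For a monomial ideal $I\subseteq S$ let $G(I)$ be its set of minimal monomial generators, and let $I_{\langle j\rangle}$ be the ideal generated by all monomials of degree $j$ belonging to $I$. With respect to the minimal $\mathbb{Z}^n$-graded free resolution $0\to F_p\to\cdots\to F_0\to J\to 0$ of a monomial ideal $J$, let $\beta_{i,j}(J)$ be the number of basis elements of $F_i$ whose multidegree $\mathbf{a}\in\mathbb{Z}^n$ satisfies $a_1+\dots+a_n=j$. The ideal $J$ has a linear resolution if there is an integer $d$ such that $\beta_{i,i+t}(J)=0$ for all $i$ and all $t\neq d$, and $I$ is componentwise linear if $I_{\langle j\rangle}$ has a linear resolution for all $j$. Let $I\subseteq S$ be a square-free monomial ideal (an ideal generated by square-free monomials) which contains none of the variables $x_1,\dots,x_n$, and assume that $I^s$ is componentwise linear for some integer $s\geq 1$. Then $I$ satisfies the gcd condition: for any two distinct monomials $u,v\in G(I)$ with $\gcd(u,v)=1$ there exists a monomial $w\in G(I)$ with $w\neq u$, $w\neq v$ and $w\mid \operatorname{lcm}(u,v)=uv$. -/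

import Mathlib

namespace MonIdeal

open MvPolynomial

/-- A monomial `x₁^{a₁} ⋯ xₙ^{aₙ}` of `S = K[x₁, …, xₙ]` (with coefficient `1`). -/
def IsMon {K : Type*} [Field K] {n : ℕ} (u : MvPolynomial (Fin n) K) : Prop :=
  ∃ a : Fin n →₀ ℕ, u = monomial a 1

/-- A square-free monomial ideal: an ideal generated by a set of square-free monomials. -/
def IsSquarefreeMonomialIdeal {K : Type*} [Field K] {n : ℕ}
    (I : Ideal (MvPolynomial (Fin n) K)) : Prop :=
  ∃ A : Set (MvPolynomial (Fin n) K), (∀ u ∈ A, IsMon u ∧ Squarefree u) ∧ I = Ideal.span A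

/-- `G(I)`: the minimal monomial generators of a monomial ideal `I`, i.e. the monomials of `I`
that are minimal with respect to divisibility. -/
def minGens {K : Type*} [Field K] {n : ℕ} (I : Ideal (MvPolynomial (Fin n) K)) :
    Set (MvPolynomial (Fin n) K) :=
  {u | IsMon u ∧ u ∈ I ∧ ∀ v, IsMon v → v ∈ I → v ∣ u → v = u}

/-- The gcd condition: for any two distinct `u, v ∈ G(I)` with `gcd(u, v) = 1` there is
`w ∈ G(I)`, `w ≠ u, v`, dividing `lcm(u, v) = u v`. -/
def GcdCondition {K : Type*} [Field K] {n : ℕ} (I : Ideal (MvPolynomial (Fin n) K)) : Prop :=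
  ∀ u ∈ minGens I, ∀ v ∈ minGens I, u ≠ v → IsRelPrime u v →
    ∃ w ∈ minGens I, w ≠ u ∧ w ≠ v ∧ w ∣ u * v

/-- The vector `f` of the free module `⨁_c S(-deg c)` is homogeneous of multidegree `a ∈ ℤⁿ`:
each monomial `x^m` occurring in the coordinate at `c` satisfies `m + deg c = a`. -/
def IsHomogeneousVec {K : Type*} [Field K] {n r : ℕ} (deg : Fin r → Fin n → ℤ)
    (a : Fin n → ℤ) (f : Fin r → MvPolynomial (Fin n) K) : Prop :=
  ∀ c, ∀ m ∈ (f c).support, ∀ k, (m k : ℤ) + deg c k = a k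

/-- A minimal `ℤⁿ`-graded free resolution
`0 → F_p → ⋯ → F₁ → F₀ → I → 0` of an ideal `I ⊆ S`, where
`F_i = ⨁_b S(-deg i b)`, `b` running over the `rank i` basis elements of `F_i`. -/
structure MinimalGradedFreeResolution {K : Type*} [Field K] {n : ℕ}
    (I : Ideal (MvPolynomial (Fin n) K)) where
  /-- the number of basis elements of `F_i` -/
  rank : ℕ → ℕ
  /-- the multidegrees of the basis elements of `F_i` -/
  deg : ∀ i, Fin (rank i) → Fin n → ℤ
  /-- the augmentation `F₀ → I ⊆ S` -/
  aug : (Fin (rank 0) → MvPolynomial (Fin n) K) →ₗ[MvPolynomial (Fin n) K] MvPolynomial (Fin n) K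
  /-- the differentials `F_{i+1} → F_i` -/
  d : ∀ i, (Fin (rank (i + 1)) → MvPolynomial (Fin n) K) →ₗ[MvPolynomial (Fin n) K]
    (Fin (rank i) → MvPolynomial (Fin n) K)
  /-- the resolution has finite length -/
  finite_length : ∃ p, ∀ i, p < i → rank i = 0
  /-- the augmentation is graded: basis elements go to homogeneous elements of the same degree -/
  aug_graded : ∀ b, ∀ m ∈ (aug (Pi.single b 1)).support, ∀ k, (m k : ℤ) = deg 0 b k
  /-- the differentials are graded: basis elements go to homogeneous elements of the same degree -/
  d_graded : ∀ i b, IsHomogeneousVec (deg i) (deg (i + 1) b) (d i (Pi.single b 1))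
  /-- `F₀ → I` is surjective -/
  range_aug : LinearMap.range aug = I
  /-- exactness at `F₀` -/
  exact_zero : Function.Exact (d 0) aug
  /-- exactness at `F_{i+1}` -/
  exact_succ : ∀ i, Function.Exact (d (i + 1)) (d i)
  /-- minimality: the image of `F_{i+1} → F_i` lies in `(x₁, …, xₙ) F_i` -/
  minimal : ∀ i f c, d i f c ∈ Ideal.span (Set.range (X : Fin n → MvPolynomial (Fin n) K))

/-- The `i`-th `ℤ`-graded Betti number `β_{i,j} = ∑_{|a| = j} β_{i,a}` read off a minimal graded
free resolution: the number of basis elements of `F_i` whose multidegree `a` has `|a| = j`. -/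
def MinimalGradedFreeResolution.betti {K : Type*} [Field K] {n : ℕ}
    {I : Ideal (MvPolynomial (Fin n) K)} (F : MinimalGradedFreeResolution I)
    (i : ℕ) (j : ℤ) : ℕ :=
  Fintype.card {b : Fin (F.rank i) // ∑ k, F.deg i b k = j}

/-- `I` has a linear resolution: for some integer `t₀`, `β_{i,i+t}(I) = 0` for all `i` and all
`t ≠ t₀`. (Minimal graded free resolutions are unique up to isomorphism, so it does not matter
which one the Betti numbers are read off.) -/
def HasLinearResolution {K : Type*} [Field K] {n : ℕ}
    (I : Ideal (MvPolynomial (Fin n) K)) : Prop :=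
  ∃ F : MinimalGradedFreeResolution I, ∃ t₀ : ℤ, ∀ (i : ℕ) (t : ℤ), t ≠ t₀ → F.betti i (i + t) = 0

/-- `I_{⟨j⟩}`: the ideal generated by all monomials of degree `j` belonging to `I`. -/
noncomputable def degreePart {K : Type*} [Field K] {n : ℕ} (I : Ideal (MvPolynomial (Fin n) K)) (j : ℕ) :
    Ideal (MvPolynomial (Fin n) K) :=
  Ideal.span {u | IsMon u ∧ u.totalDegree = j ∧ u ∈ I}

/-- A monomial ideal `I` is componentwise linear if every `I_{⟨j⟩}` has a linear resolution. -/
def IsComponentwiseLinear {K : Type*} [Field K] {n : ℕ}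
    (I : Ideal (MvPolynomial (Fin n) K)) : Prop :=
  ∀ j, HasLinearResolution (degreePart I j)

end MonIdeal

namespace MonIdeal

open MvPolynomial

/-! Suppose `u, v ∈ G(I)` are coprime, `deg u ≤ deg v`, and no other generator divides `uv`. For the
power `s + 1`, put `j = deg (u ^ s v)` and `M = u ^ (s + 1) v`. In degree `j`, the power contains `p
= u ^ s v` and `q = u ^ (s + 1) e`, where `e ∣ v` has degree `deg v - deg u`; both divide `M`.
Linearity of the degree `j` component forces a monomial `m ≠ p` of degree `j` in the power, dividing
`M`, such that `p` and `m` have a common multiple of degree `j + 1` (`exists_linear_link`). By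
`le_or_le_of_mem_pow`, `m` is a multiple of `p`, hence equal to `p`, or of `u ^ (s + 1)`. In the
latter case the common multiple is divisible by `M`, of degree `j + deg u ≥ j + 2`: a contradiction.
-/

lemma exists_mem_support_le_of_coeff_mul_ne_zero {K σ : Type*} [Field K] {f g : MvPolynomial σ K}
    {M : σ →₀ ℕ} (h : coeff M (f * g) ≠ 0) : ∃ m ∈ g.support, m ≤ M := by
  classical
  rw [coeff_mul] at h
  obtain ⟨x, hx, hne⟩ := Finset.exists_ne_zero_of_sum_ne_zero h
  refine ⟨x.2, ?_, ?_⟩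
  · rw [mem_support_iff]
    exact right_ne_zero_of_mul hne
  · rw [← Finset.HasAntidiagonal.mem_antidiagonal.mp hx]
    exact le_add_self

lemma eq_of_le_of_sum_eq {n : ℕ} {m m' : Fin n →₀ ℕ} (hle : m ≤ m')
    (hs : ∑ k, m k = ∑ k, m' k) : m = m' := by
  ext k
  exact (Finset.sum_eq_sum_iff_of_le (fun i _ => hle i)).mp hs k (Finset.mem_univ k)

variable {K : Type*} [Field K] {n : ℕ}

/-! ### Linear resolutions and linear syzygies. -/

lemma MinimalGradedFreeResolution.sum_deg_eq {I : Ideal (MvPolynomial (Fin n) K)}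
    (F : MinimalGradedFreeResolution I) {t₀ : ℤ}
    (h : ∀ (i : ℕ) (t : ℤ), t ≠ t₀ → F.betti i (i + t) = 0) (i : ℕ) (b : Fin (F.rank i)) :
    ∑ k, F.deg i b k = i + t₀ := by
  by_contra hne
  have := h i (∑ k, F.deg i b k - i) (by intro h'; apply hne; rw [← h']; ring)
  rw [betti, Fintype.card_eq_zero_iff] at this
  exact this.elim ⟨b, by ring⟩

lemma MinimalGradedFreeResolution.aug_apply {I : Ideal (MvPolynomial (Fin n) K)}
    (F : MinimalGradedFreeResolution I) (z : Fin (F.rank 0) → MvPolynomial (Fin n) K) :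
    F.aug z = ∑ b, z b * F.aug (Pi.single b 1) := by
  rw [LinearMap.pi_apply_eq_sum_univ F.aug z]
  refine Finset.sum_congr rfl fun b _ => ?_
  rw [smul_eq_mul]
  congr 2
  ext1 j
  simp [Pi.single_apply, eq_comm]

/-- The part of the augmentation coming from the basis elements of multidegree `p`. -/
noncomputable def MinimalGradedFreeResolution.augPart {I : Ideal (MvPolynomial (Fin n) K)}
    (F : MinimalGradedFreeResolution I) (p : Fin n →₀ ℕ) :
    (Fin (F.rank 0) → MvPolynomial (Fin n) K) →ₗ[MvPolynomial (Fin n) K]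
      MvPolynomial (Fin n) K :=
  open Classical in
  ∑ b, if ∀ k, F.deg 0 b k = p k then
    (LinearMap.toSpanSingleton _ _ (F.aug (Pi.single b 1))) ∘ₗ LinearMap.proj b else 0

open Classical in
lemma MinimalGradedFreeResolution.augPart_apply {I : Ideal (MvPolynomial (Fin n) K)}
    (F : MinimalGradedFreeResolution I) (p : Fin n →₀ ℕ)
    (z : Fin (F.rank 0) → MvPolynomial (Fin n) K) :
    F.augPart p z =
      ∑ b, if ∀ k, F.deg 0 b k = p k then z b * F.aug (Pi.single b 1) else 0 := by
  rw [augPart, LinearMap.sum_apply]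
  refine Finset.sum_congr rfl fun b _ => ?_
  split_ifs <;> simp [LinearMap.toSpanSingleton_apply]

/-- If all the minimal syzygies of an ideal generated in degree `j` are linear, two generators of
degree `j` dividing `M` are linked by linear syzygies of multidegree dividing `M`. -/
lemma exists_linear_link {J : Ideal (MvPolynomial (Fin n) K)} (hlin : HasLinearResolution J)
    {j : ℕ} (hJ : ∀ f ∈ J, ∀ m ∈ f.support, j ≤ ∑ k, m k)
    {p q M : Fin n →₀ ℕ} (hp : monomial p 1 ∈ J) (hq : monomial q 1 ∈ J)
    (hpM : p ≤ M) (hqM : q ≤ M) (hpq : p ≠ q) (hpj : ∑ k, p k = j) (hqj : ∑ k, q k = j) :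
    ∃ f ∈ J, ∃ m ∈ f.support, m ≠ p ∧ m ≤ M ∧ ∑ k, m k = j ∧
      ∃ c : Fin n →₀ ℕ, ∑ k, c k = j + 1 ∧ p ≤ c ∧ m ≤ c ∧ c ≤ M := by
  classical
  obtain ⟨F, t₀, hF⟩ := hlin
  by_contra H
  have h0 : ∀ b, ∑ k, F.deg 0 b k = t₀ := fun b => by simpa using F.sum_deg_eq hF 0 b
  have h1 : ∀ c, ∑ k, F.deg 1 c k = 1 + t₀ := fun c => by simpa using F.sum_deg_eq hF 1 c
  have haugJ : ∀ z, F.aug z ∈ J := fun z => by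
    have h := LinearMap.mem_range_self F.aug z
    rwa [F.range_aug] at h
  have hsum : ∀ b, ∀ m ∈ (F.aug (Pi.single b 1)).support, ((∑ k, m k : ℕ) : ℤ) = t₀ := by
    intro b m hm
    rw [← h0 b]
    push_cast
    exact Finset.sum_congr rfl fun k _ => F.aug_graded b m hm k
  obtain ⟨zp, hzp⟩ := F.range_aug.ge hp
  obtain ⟨zq, hzq⟩ := F.range_aug.ge hq
  -- Some generator, of degree `t₀`, has a monomial dividing `p`, so `t₀ ≤ j`; nothing in `J` lies
  -- below degree `j`.
  have ht : t₀ = j := by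
    have h : coeff p (F.aug zp) ≠ 0 := by simp [hzp]
    rw [F.aug_apply, coeff_sum] at h
    obtain ⟨b, -, hb⟩ := Finset.exists_ne_zero_of_sum_ne_zero h
    obtain ⟨m, hm, hmp⟩ := exists_mem_support_le_of_coeff_mul_ne_zero hb
    have e1 := hsum b m hm
    have e2 := hJ _ (haugJ _) m hm
    have e3 : ∑ k, m k ≤ ∑ k, p k := Finset.sum_le_sum fun k _ => hmp k
    omega
  have hsum' : ∀ b, ∀ m ∈ (F.aug (Pi.single b 1)).support, ∑ k, m k = j := by
    intro b m hm
    have := hsum b m hm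
    omega
  -- the coefficients at a monomial of degree `j`
  have hcoeff : ∀ z (r : Fin n →₀ ℕ), ∑ k, r k = j →
      coeff r (F.augPart p z) = if r = p then coeff r (F.aug z) else 0 := by
    intro z r hr
    -- By degree, only the constant term of `z b` can contribute at `r`, so the basis element has
    -- multidegree `r`.
    have key : ∀ b, coeff r (z b * F.aug (Pi.single b 1)) ≠ 0 → ∀ k, F.deg 0 b k = r k := by
      intro b hb k
      obtain ⟨m, hm, hmr⟩ := exists_mem_support_le_of_coeff_mul_ne_zero hb
      have : m = r := eq_of_le_of_sum_eq hmr (by rw [hr, hsum' b m hm])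
      rw [← this, F.aug_graded b m hm k]
    rw [F.augPart_apply, F.aug_apply, coeff_sum, coeff_sum]
    split_ifs with hrp
    · refine Finset.sum_congr rfl fun b _ => ?_
      split_ifs with hb
      · rfl
      · by_contra hne
        exact hb (by rw [← hrp]; exact key b (by simpa [eq_comm] using hne))
    · refine Finset.sum_eq_zero fun b _ => ?_
      split_ifs with hb
      · by_contra hne
        apply hrp
        ext k
        have := key b hne k
        have := hb k
        omega
      · simp
  -- A nonzero coefficient needs a monomial `m` of degree `j + 1` with `p ≤ m ≤ M`. Without a link,
  -- every basis element contributing to `aug` at `m` has multidegree `p`, so `augPart p` agrees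
  -- there with `aug`, which kills the image of `d 0`.
  have hd : ∀ c (g : MvPolynomial (Fin n) K),
      coeff M (g * F.augPart p (F.d 0 (Pi.single c 1))) = 0 := by
    intro c g
    by_contra hne
    obtain ⟨m, hm, hmM⟩ := exists_mem_support_le_of_coeff_mul_ne_zero hne
    have hdeg : ∀ b, ∀ m, coeff m (F.d 0 (Pi.single c 1) b * F.aug (Pi.single b 1)) ≠ 0 →
        (∀ k, (m k : ℤ) = F.deg 1 c k) ∧
          ∃ m' ∈ (F.aug (Pi.single b 1)).support, m' ≤ m := by
      intro b m hb
      refine ⟨?_, exists_mem_support_le_of_coeff_mul_ne_zero hb⟩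
      rw [coeff_mul] at hb
      obtain ⟨x, hx, hb⟩ := Finset.exists_ne_zero_of_sum_ne_zero hb
      intro k
      have e1 := F.d_graded 0 c b x.1 (mem_support_iff.mpr (left_ne_zero_of_mul hb)) k
      have e2 := F.aug_graded b x.2 (mem_support_iff.mpr (right_ne_zero_of_mul hb)) k
      rw [← Finset.HasAntidiagonal.mem_antidiagonal.mp hx, ← e1, ← e2]
      simp
    rw [mem_support_iff] at hm
    have hm0 := hm
    rw [F.augPart_apply, coeff_sum] at hm
    obtain ⟨b, -, hb⟩ := Finset.exists_ne_zero_of_sum_ne_zero hm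
    have hbp : ∀ k, F.deg 0 b k = p k := by
      by_contra h
      simp [h] at hb
    rw [if_pos hbp] at hb
    obtain ⟨hmc, m', hm', hle⟩ := hdeg b m hb
    have hpm : p ≤ m := by
      have : m' = p := by
        ext k
        have := F.aug_graded b m' hm' k
        have := hbp k
        omega
      exact this ▸ hle
    have hmj : ∑ k, m k = j + 1 := by
      have : ((∑ k, m k : ℕ) : ℤ) = 1 + t₀ := by
        rw [← h1 c]
        push_cast
        exact Finset.sum_congr rfl fun k _ => hmc k
      omega
    apply hm0
    have hz : F.aug (F.d 0 (Pi.single c 1)) = 0 := F.exact_zero.apply_apply_eq_zero _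
    rw [← coeff_zero (R := K) m, ← hz, F.augPart_apply, F.aug_apply, coeff_sum, coeff_sum]
    refine Finset.sum_congr rfl fun b' _ => ?_
    split_ifs with hb'
    · rfl
    · by_contra hne
      obtain ⟨-, m'', hm'', hle''⟩ := hdeg b' m (by simpa [eq_comm] using hne)
      refine H ⟨_, haugJ _, m'', hm'', ?_, hle''.trans hmM, hsum' b' m'' hm'', m, hmj, hpm, hle'',
        hmM⟩
      rintro rfl
      exact hb' fun k => (F.aug_graded b' _ hm'' k).symm
  have hker : ∀ z, F.aug z = 0 → coeff M (F.augPart p z) = 0 := by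
    intro z hz
    obtain ⟨y, rfl⟩ := (F.exact_zero z).mp hz
    have : F.augPart p (F.d 0 y) = ∑ c, y c * F.augPart p (F.d 0 (Pi.single c 1)) := by
      rw [← LinearMap.comp_apply, LinearMap.pi_apply_eq_sum_univ (F.augPart p ∘ₗ F.d 0) y]
      refine Finset.sum_congr rfl fun b _ => ?_
      rw [smul_eq_mul, LinearMap.comp_apply]
      congr 3
      ext1 j
      simp [Pi.single_apply, eq_comm]
    rw [this, coeff_sum]
    exact Finset.sum_eq_zero fun c _ => hd c _
  -- The syzygy between `p` and `q` in multidegree `M`: under `augPart p` its coefficient at `M` is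
  -- `1 - 0`, since only the `p` term survives.
  have hz := hker ((monomial (M - p) (1 : K)) • zp - (monomial (M - q) (1 : K)) • zq) (by
    rw [map_sub, map_smul, map_smul, hzp, hzq, smul_eq_mul, smul_eq_mul, monomial_mul,
      monomial_mul, tsub_add_cancel_of_le hpM, tsub_add_cancel_of_le hqM, sub_self])
  rw [map_sub, map_smul, map_smul, smul_eq_mul, smul_eq_mul, coeff_sub, coeff_monomial_mul',
    coeff_monomial_mul', if_pos tsub_le_self, if_pos tsub_le_self, tsub_tsub_cancel_of_le hpM,
    tsub_tsub_cancel_of_le hqM, hcoeff zp p hpj, hcoeff zq q hqj, if_pos rfl,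
    if_neg (Ne.symm hpq), hzp] at hz
  simp at hz

/-! ### Exponent vectors, monomial ideals and minimal generators. -/

lemma exists_le_sum_eq {n : ℕ} (v : Fin n →₀ ℕ) {t : ℕ} (ht : t ≤ ∑ k, v k) :
    ∃ m ≤ v, ∑ k, m k = t := by
  induction t with
  | zero => exact ⟨0, zero_le, by simp⟩
  | succ t ih =>
    obtain ⟨m, hm, hs⟩ := ih (by omega)
    obtain ⟨k, -, hk⟩ : ∃ k ∈ Finset.univ, m k < v k :=
      Finset.exists_lt_of_sum_lt (by omega)
    refine ⟨m + Finsupp.single k 1, fun i => ?_, ?_⟩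
    · have := hm i
      by_cases h : k = i
      · subst h; simp; omega
      · simpa [Finsupp.single_apply, h] using this
    · simp [Finset.sum_add_distrib, hs, Finsupp.single_apply]

lemma monomial_one_dvd_iff {a b : Fin n →₀ ℕ} :
    monomial a (1 : K) ∣ monomial b 1 ↔ a ≤ b := by
  simp [monomial_dvd_monomial]

lemma monomial_one_inj {a b : Fin n →₀ ℕ} :
    monomial a (1 : K) = monomial b 1 ↔ a = b := by
  rw [(monomial_left_injective (one_ne_zero : (1 : K) ≠ 0)).eq_iff]

lemma le_one_of_squarefree {a : Fin n →₀ ℕ} (h : Squarefree (monomial a (1 : K))) (k : Fin n) :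
    a k ≤ 1 := by
  by_contra! hk
  have : (X k : MvPolynomial (Fin n) K) * X k ∣ monomial a 1 := by
    rw [X, monomial_mul, ← Finsupp.single_add, one_mul, monomial_one_dvd_iff]
    intro i
    by_cases h : k = i
    · subst h; simp; omega
    · simp [h]
  have h' := h _ this
  have h1 : monomial (Finsupp.single k 1) (1 : K) ∣ monomial 0 1 := by
    simpa [X] using h'.dvd
  rw [monomial_one_dvd_iff] at h1
  simpa using h1 k

lemma eq_zero_or_of_isRelPrime {a b : Fin n →₀ ℕ}
    (h : IsRelPrime (monomial a (1 : K)) (monomial b 1)) (k : Fin n) : a k = 0 ∨ b k = 0 := by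
  by_contra! hk
  have aux : ∀ c : Fin n →₀ ℕ, c k ≠ 0 → monomial (Finsupp.single k 1) (1 : K) ∣ monomial c 1 := by
    intro c hc
    rw [monomial_one_dvd_iff]
    intro i
    by_cases h : k = i
    · subst h; simp; omega
    · simp [h]
  have h' := h (aux a hk.1) (aux b hk.2)
  have h1 : monomial (Finsupp.single k 1) (1 : K) ∣ monomial 0 1 := by
    simpa using h'.dvd
  rw [monomial_one_dvd_iff] at h1
  simpa using h1 k

/-- The monomials of the powers of a monomial ideal. -/
lemma exists_sum_le_of_mem_pow {A : Set (MvPolynomial (Fin n) K)} (hA : ∀ u ∈ A, IsMon u)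
    (s : ℕ) {f : MvPolynomial (Fin n) K} (hf : f ∈ Ideal.span A ^ s) {m : Fin n →₀ ℕ}
    (hm : m ∈ f.support) :
    ∃ g : Fin s → Fin n →₀ ℕ, (∀ i, monomial (g i) 1 ∈ A) ∧ ∑ i, g i ≤ m := by
  have key : ∀ s : ℕ, Ideal.span A ^ s = Ideal.span ((fun a => monomial a (1 : K)) ''
      {a | ∃ g : Fin s → Fin n →₀ ℕ, (∀ i, monomial (g i) (1 : K) ∈ A) ∧ ∑ i, g i = a}) := by
    intro s
    induction s with
    | zero => simp
    | succ s ih =>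
      rw [pow_succ, ih, Ideal.span_mul_span']
      congr 1
      ext x
      simp only [Set.mem_mul, Set.mem_image, Set.mem_ofPred_eq]
      constructor
      · rintro ⟨_, ⟨_, ⟨g, hg, rfl⟩, rfl⟩, y, hy, rfl⟩
        obtain ⟨a, rfl⟩ := hA y hy
        refine ⟨_, ⟨Fin.snoc (α := fun _ => Fin n →₀ ℕ) g a, ?_, rfl⟩, ?_⟩
        · intro i
          refine Fin.lastCases ?_ (fun i => ?_) i
          · simpa using hy
          · simpa using hg i
        · simp [Fin.sum_univ_castSucc, monomial_mul]
      · rintro ⟨_, ⟨g, hg, rfl⟩, rfl⟩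
        refine ⟨_, ⟨_, ⟨fun i => g i.castSucc, fun i => hg _, rfl⟩, rfl⟩, _, hg (Fin.last s), ?_⟩
        simp [Fin.sum_univ_castSucc, monomial_mul]
  rw [key, mem_ideal_span_monomial_image] at hf
  obtain ⟨a, ⟨g, hg, rfl⟩, hle⟩ := hf m hm
  exact ⟨g, hg, hle⟩

/-- The monomials occurring in the elements of `I_{⟨j⟩}`. -/
lemma exists_le_of_mem_degreePart {I : Ideal (MvPolynomial (Fin n) K)} {j : ℕ}
    {f : MvPolynomial (Fin n) K} (hf : f ∈ degreePart I j) {m : Fin n →₀ ℕ} (hm : m ∈ f.support) :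
    ∃ a ≤ m, ∑ k, a k = j ∧ monomial a 1 ∈ I := by
  have : {u : MvPolynomial (Fin n) K | IsMon u ∧ u.totalDegree = j ∧ u ∈ I} =
      (fun a => monomial a (1 : K)) '' {a | ∑ k, a k = j ∧ monomial a 1 ∈ I} := by
    ext u
    simp only [Set.mem_ofPred_eq, Set.mem_image]
    constructor
    · rintro ⟨⟨a, rfl⟩, h1, h2⟩
      refine ⟨a, ⟨?_, h2⟩, rfl⟩
      rwa [totalDegree_monomial _ one_ne_zero, Finsupp.sum_fintype _ _ (by simp)] at h1
    · rintro ⟨a, ⟨h1, h2⟩, rfl⟩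
      refine ⟨⟨a, rfl⟩, ?_, h2⟩
      rwa [totalDegree_monomial _ one_ne_zero, Finsupp.sum_fintype _ _ (by simp)]
  rw [degreePart, this, mem_ideal_span_monomial_image] at hf
  obtain ⟨a, ⟨h1, h2⟩, hle⟩ := hf m hm
  exact ⟨a, hle, h1, h2⟩

lemma monomial_mem_degreePart {I : Ideal (MvPolynomial (Fin n) K)} {j : ℕ} {a : Fin n →₀ ℕ}
    (h : monomial a 1 ∈ I) (hj : ∑ k, a k = j) : monomial a 1 ∈ degreePart I j := by
  refine Ideal.subset_span ⟨⟨a, rfl⟩, ?_, h⟩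
  rwa [totalDegree_monomial _ one_ne_zero, Finsupp.sum_fintype _ _ (by simp)]

lemma exists_minGens_dvd {I : Ideal (MvPolynomial (Fin n) K)} {a : Fin n →₀ ℕ}
    (h : monomial a 1 ∈ I) : ∃ b ≤ a, monomial b 1 ∈ minGens I := by
  obtain ⟨b, hb, hmin⟩ := WellFounded.has_min (wellFounded_lt (α := Fin n →₀ ℕ))
    {b | b ≤ a ∧ monomial b (1 : K) ∈ I} ⟨a, le_rfl, h⟩
  refine ⟨b, hb.1, ⟨b, rfl⟩, hb.2, ?_⟩
  rintro _ ⟨c, rfl⟩ hc hdvd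
  rw [monomial_one_dvd_iff] at hdvd
  rw [monomial_one_inj]
  by_contra hne
  exact hmin c ⟨hdvd.trans hb.1, hc⟩ (lt_of_le_of_ne hdvd hne)

lemma le_one_of_mem_minGens {I : Ideal (MvPolynomial (Fin n) K)}
    (hI : IsSquarefreeMonomialIdeal I) {a : Fin n →₀ ℕ} (h : monomial a 1 ∈ minGens I)
    (k : Fin n) : a k ≤ 1 := by
  obtain ⟨A, hA, rfl⟩ := hI
  -- The first power shows that `a` is a multiple of some member of `A`; minimality then makes them
  -- equal.
  obtain ⟨g, hg, hle⟩ := exists_sum_le_of_mem_pow (fun u hu => (hA u hu).1) 1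
    (by simpa using h.2.1) (m := a) (by simp)
  simp only [Finset.univ_unique, Fin.default_eq_zero, Finset.sum_singleton] at hle
  have := h.2.2 _ ⟨_, rfl⟩ (Ideal.subset_span (hg 0)) (monomial_one_dvd_iff.mpr hle)
  rw [monomial_one_inj] at this
  exact le_one_of_squarefree (this ▸ (hA _ (hg 0)).2) k

/-- Degree 0 would give the generator `1`, which divides the other one; degree 1 would give a
variable. -/
lemma two_le_of_mem_minGens {I : Ideal (MvPolynomial (Fin n) K)}
    (hvar : ∀ k : Fin n, X k ∉ I) {a b : Fin n →₀ ℕ} (ha : monomial a 1 ∈ minGens I)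
    (hb : monomial b 1 ∈ minGens I) (hne : a ≠ b) : 2 ≤ ∑ k, a k := by
  by_contra! hlt
  obtain h | h : ∑ k, a k = 0 ∨ ∑ k, a k = 1 := by omega
  · have h0 : a = 0 := by
      ext k
      exact Finset.sum_eq_zero_iff.mp h k (Finset.mem_univ k)
    apply hne
    rw [← monomial_one_inj (K := K)]
    exact hb.2.2 _ ⟨a, rfl⟩ ha.2.1 (monomial_one_dvd_iff.mpr (h0 ▸ zero_le))
  · obtain ⟨k, -, hk⟩ := Finset.exists_ne_zero_of_sum_ne_zero (by omega : ∑ k, a k ≠ 0)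
    have : Finsupp.single k 1 = a := by
      refine eq_of_le_of_sum_eq (fun i => ?_) (by simp [h, Finsupp.single_apply])
      by_cases hi : k = i
      · subst hi; simp; omega
      · simp [hi]
    apply hvar k
    rw [X, this]
    exact ha.2.1

/-! ### Monomials of the power and the missing linear link. -/

/-- If `u, v ∈ G(I)` are coprime and no other generator divides `u v`, then every monomial of `I ^ s`
dividing `u ^ s v` is a multiple of `u ^ s` or of `u ^ (s - 1) v`. -/
lemma le_or_le_of_mem_pow {I : Ideal (MvPolynomial (Fin n) K)}
    (hI : IsSquarefreeMonomialIdeal I) {a b : Fin n →₀ ℕ} (hb : ∃ k, b k ≠ 0)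
    (hab : ∀ k, a k = 0 ∨ b k = 0)
    (hw : ∀ w, monomial w 1 ∈ minGens I → w ≤ a + b → w = a ∨ w = b) (s : ℕ)
    {f : MvPolynomial (Fin n) K} (hf : f ∈ I ^ (s + 1)) {m : Fin n →₀ ℕ} (hm : m ∈ f.support)
    (hmM : m ≤ (s + 1) • a + b) (hb1 : ∀ k, b k ≤ 1) :
    (s + 1) • a ≤ m ∨ s • a + b ≤ m := by
  obtain ⟨A, hA, rfl⟩ := id hI
  obtain ⟨g, hg, hle⟩ := exists_sum_le_of_mem_pow (fun u hu => (hA u hu).1) (s + 1) hf hm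
  have hgi : ∀ i, a ≤ g i ∨ b ≤ g i := by
    intro i
    obtain ⟨w, hwle, hw'⟩ := exists_minGens_dvd (Ideal.subset_span (hg i))
    -- As `w` is square-free, only its support matters: where `a` vanishes, `w` is bounded by `b`.
    have : w ≤ a + b := by
      intro k
      have e1 : w k ≤ g i k := hwle k
      have e2 := le_one_of_mem_minGens hI hw' k
      have e3 : g i k ≤ m k :=
        (Finset.single_le_sum (f := g) (fun _ _ => zero_le) (Finset.mem_univ i)).trans hle k
      have e4 := hmM k
      simp only [Finsupp.add_apply, Finsupp.smul_apply, smul_eq_mul] at e4 ⊢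
      by_contra hlt
      have : a k = 0 := by omega
      rw [this] at e4
      omega
    rcases hw w hw' this with rfl | rfl
    · exact Or.inl hwle
    · exact Or.inr hwle
  by_cases hall : ∀ i, a ≤ g i
  · left
    refine le_trans ?_ hle
    calc (s + 1) • a = ∑ _i : Fin (s + 1), a := by simp
      _ ≤ _ := Finset.sum_le_sum fun i _ => hall i
  · right
    push Not at hall
    obtain ⟨i₀, hi₀⟩ := hall
    have hb0 : b ≤ g i₀ := (hgi i₀).resolve_left hi₀
    -- Two factors divisible by `v` would give exponent at least 2 at a variable of `v`, where `u ^
    -- (s + 1) v` has exponent 1.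
    have hne : ∀ i ≠ i₀, a ≤ g i := by
      intro i hi
      refine (hgi i).resolve_right fun hbi => ?_
      obtain ⟨k, hk⟩ := hb
      have e1 : g i + g i₀ ≤ m := by
        rw [← Finset.sum_pair hi]
        exact (Finset.sum_le_sum_of_subset (Finset.subset_univ _)).trans hle
      have e2 := e1 k
      have e3 := hbi k
      have e4 := hb0 k
      have e5 := hmM k
      have e6 := (hab k).resolve_right hk
      have e7 := hb1 k
      simp only [Finsupp.add_apply, Finsupp.smul_apply, smul_eq_mul, e6] at e2 e5
      omega
    refine le_trans ?_ hle
    rw [← Finset.sum_erase_add _ _ (Finset.mem_univ i₀)]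
    refine add_le_add ?_ hb0
    calc s • a = ∑ _i ∈ Finset.univ.erase i₀, a := by simp
      _ ≤ _ := Finset.sum_le_sum fun i hi => hne i (Finset.ne_of_mem_erase hi)

/-- The failure occurs in degree `j = deg (u ^ s v)`: inside `u ^ (s + 1) v`, the only other
monomials of the power are multiples of `u ^ (s + 1)`, too far from `u ^ s v` for a linear syzygy.
-/
lemma not_isComponentwiseLinear_pow {I : Ideal (MvPolynomial (Fin n) K)}
    (hI : IsSquarefreeMonomialIdeal I) {a b : Fin n →₀ ℕ}
    (ha : monomial a 1 ∈ I) (hb : monomial b 1 ∈ I) (hb1 : ∀ k, b k ≤ 1)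
    (ha2 : 2 ≤ ∑ k, a k) (hle : ∑ k, a k ≤ ∑ k, b k) (hab : ∀ k, a k = 0 ∨ b k = 0)
    (hw : ∀ w, monomial w 1 ∈ minGens I → w ≤ a + b → w = a ∨ w = b) (s : ℕ) :
    ¬ IsComponentwiseLinear (I ^ (s + 1)) := by
  intro hlin
  have hbk : ∃ k, b k ≠ 0 := by
    obtain ⟨k, -, hk⟩ := Finset.exists_ne_zero_of_sum_ne_zero (by omega : ∑ k, b k ≠ 0)
    exact ⟨k, hk⟩
  -- The factor `e` of `v` pads `u ^ (s + 1)` up to degree `j`; this needs `deg u ≤ deg v`.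
  obtain ⟨e, heb, he⟩ := exists_le_sum_eq b (Nat.sub_le (∑ k, b k) (∑ k, a k))
  have hsmul : ∀ t : ℕ, ∑ k, (t • a) k = t * ∑ k, a k := fun t => by simp [Finset.mul_sum]
  have hadd : ∀ x y : Fin n →₀ ℕ, ∑ k, (x + y) k = ∑ k, x k + ∑ k, y k := fun x y => by
    simp [Finset.sum_add_distrib]
  set j := ∑ k, (s • a + b) k with hj
  have hj' : j = s * ∑ k, a k + ∑ k, b k := by rw [hj, hadd, hsmul]
  have hpow : ∀ t : ℕ, monomial (t • a) (1 : K) ∈ I ^ t := fun t => by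
    simpa [monomial_pow] using Ideal.pow_mem_pow ha t
  have hqj : ∑ k, ((s + 1) • a + e) k = j := by
    rw [hadd, hsmul, he, hj', add_mul]
    omega
  have hp : monomial (s • a + b) (1 : K) ∈ I ^ (s + 1) := by
    simpa [monomial_mul, pow_succ] using Ideal.mul_mem_mul (hpow s) hb
  have hq : monomial ((s + 1) • a + e) (1 : K) ∈ I ^ (s + 1) := by
    simpa [monomial_mul] using Ideal.mul_mem_right (monomial e (1 : K)) _ (hpow (s + 1))
  -- `u ^ (s + 1)` divides no monomial `c` of degree at most `j + 1` that `u ^ s v` divides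
  have hfar : ∀ c : Fin n →₀ ℕ, ∑ k, c k ≤ j + 1 → s • a + b ≤ c → ¬ (s + 1) • a ≤ c := by
    intro c hc hpc hac
    -- By coprimality the lcm of `u ^ (s + 1)` and `u ^ s v` is `u ^ (s + 1) v`, whose degree
    -- exceeds `j` by `deg u ≥ 2`.
    have : (s + 1) • a + b ≤ c := by
      intro k
      have e1 := hpc k
      have e2 := hac k
      simp only [Finsupp.add_apply, Finsupp.smul_apply, smul_eq_mul] at e1 e2 ⊢
      rcases hab k with h | h
      · rw [h] at e1 ⊢
        simpa using e1
      · rw [h]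
        simpa using e2
    have h2 : ∑ k, ((s + 1) • a + b) k ≤ ∑ k, c k := Finset.sum_le_sum fun k _ => this k
    rw [hadd, hsmul, add_mul] at h2
    omega
  obtain ⟨f, hf, m, hm, hmp, hmM, hmj, c, hcj, hpc, hmc, -⟩ := exists_linear_link (hlin j)
    (j := j) (p := s • a + b) (q := (s + 1) • a + e) (M := (s + 1) • a + b)
    (fun f hf m hm => by
      obtain ⟨x, hx, hxj, -⟩ := exists_le_of_mem_degreePart hf hm
      rw [← hxj]
      exact Finset.sum_le_sum fun k _ => hx k)
    (monomial_mem_degreePart hp rfl) (monomial_mem_degreePart hq hqj)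
    (by gcongr; omega) (by gcongr)
    (fun h => hfar (s • a + b) (by omega) le_rfl (h ▸ le_self_add)) rfl hqj
  obtain ⟨x, hx, hxj, hxI⟩ := exists_le_of_mem_degreePart hf hm
  obtain rfl : x = m := eq_of_le_of_sum_eq hx (by rw [hxj, hmj])
  rcases le_or_le_of_mem_pow hI hbk hab hw s hxI (by simp) hmM hb1 with h | h
  · exact hfar c hcj.le hpc (h.trans hmc)
  · exact hmp (eq_of_le_of_sum_eq h hmj.symm).symm

end MonIdeal

open MonIdeal in
theorem corollary2p3 {K : Type*} [Field K] {n : ℕ} (I : Ideal (MvPolynomial (Fin n) K))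
    (hI : MonIdeal.IsSquarefreeMonomialIdeal I)
    (hvar : ∀ k : Fin n, MvPolynomial.X k ∉ I)
    (s : ℕ) (hs : 1 ≤ s) (hlin : MonIdeal.IsComponentwiseLinear (I ^ s)) :
    MonIdeal.GcdCondition I := by
  obtain ⟨s, rfl⟩ : ∃ t, s = t + 1 := ⟨s - 1, by omega⟩
  intro u hu v hv huv hrel
  obtain ⟨a, rfl⟩ := hu.1
  obtain ⟨b, rfl⟩ := hv.1
  by_contra! H
  have hne : a ≠ b := fun h => huv (by rw [h])
  have hab := eq_zero_or_of_isRelPrime hrel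
  have hw : ∀ w, MvPolynomial.monomial w 1 ∈ minGens I → w ≤ a + b → w = a ∨ w = b := by
    intro w hw hle
    by_contra! h
    refine H _ hw (fun h' => h.1 (monomial_one_inj.mp h')) (fun h' => h.2 (monomial_one_inj.mp h'))
      ?_
    rw [MvPolynomial.monomial_mul, one_mul]
    exact monomial_one_dvd_iff.mpr hle
  have ha1 := le_one_of_mem_minGens hI hu
  have hb1 := le_one_of_mem_minGens hI hv
  -- The generator of smaller degree plays the role of `u`, the one raised to the power `s + 1`.
  rcases le_total (∑ k, a k) (∑ k, b k) with hle | hle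
  · exact not_isComponentwiseLinear_pow hI hu.2.1 hv.2.1 hb1
      (two_le_of_mem_minGens hvar hu hv hne) hle hab hw s hlin
  · exact not_isComponentwiseLinear_pow hI hv.2.1 hu.2.1 ha1
      (two_le_of_mem_minGens hvar hv hu hne.symm) hle (fun k => (hab k).symm)
      (fun w h1 h2 => (hw w h1 (by rwa [add_comm])).symm) s hlin
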